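/- Let $q$ be a prime power, let $t\ge 2$ be an even integer and let $r\ge 2$ be an integer. Let $V$ be an $r$-dimensional vector space over $\mathbb{F}_{q^t}$, so that the points of $PG(r-1,q^t)=PG(V,\mathbb{F}_{q^t})$ are the one-dimensional $\mathbb{F}_{q^t}$-subspaces of $V$. An $\mathbb{F}_q$-subspace $U$ of $V$ with $\dim_{\mathbb{F}_q}U=k$ defines the $\mathbb{F}_q$-linear set of rank $k$ $$L_U=\{\langle u\rangle_{\mathbb{F}_{q^t}} : u\in U\setminus\{0\}\},$$ and $L_U$ is called scattered if $\dim_{\mathbb{F}_q}(U\cap P)=1$ for every point $P\in L_U$. Then there exists a scattered $\mathbb{F}_q$-linear set of rank $\frac{rt}{2}$ in $PG(r-1,q^t)$ in each of the following cases: - $q=2$ and $t\geq 4$; - $q$ is an arbitrary prime power and $t\not\equiv 0 \pmod 3$; - $q\equiv 1 \pmod 3$ and $t\equiv 0 \pmod 3$. -/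

import Mathlib

namespace LinearSets

variable {F K V : Type*} [Field F] [Field K] [Algebra F K]
  [AddCommGroup V] [Module F V] [Module K V] [IsScalarTower F K V]

/-- The `F`-linear set `L_U` of the projective space `PG(V, K)` defined by the `F`-subspace `U`
of `V`: the set of the points `⟨u⟩_K` for `u` a non-zero vector of `U`.  Linear sets are considered
together with the subspace `U`; the rank of `L_U` is the dimension of `U` over `F`. -/
def linearSet (K : Type*) [Field K] [Module K V] (U : Submodule F V) :
    Set (Projectivization K V) :=
  {P | ∃ (u : V) (hu : u ≠ 0), u ∈ U ∧ P = Projectivization.mk K u hu}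

/-- The weight in `L_U` of a point `P` of `PG(V, K)`: the dimension over `F` of the intersection
of `U` with the one-dimensional `K`-subspace of `V` that is the point `P`. -/
noncomputable def weight (U : Submodule F V) (P : Projectivization K V) : ℕ :=
  Module.finrank F ↥(U ⊓ P.submodule.restrictScalars F)

/-- The linear set `L_U` is scattered if all of its points have weight 1. -/
def IsScattered (K : Type*) [Field K] [Algebra F K] [Module K V] [IsScalarTower F K V]
    (U : Submodule F V) : Prop :=
  ∀ P ∈ linearSet K U, weight U P = 1

end LinearSets

/-! It suffices to find an `F`-subspace `U` of rank `rt/2` such that only scalars in `F` send some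
nonzero vector of `U` into `U`. This property passes to direct sums, so ranks `r = 2` and `r = 3`
are enough; for `r = 2` the vectors `(x, x ^ q)` work.

For `r = 3`, let `E` be the subfield with `[K : E] = 2`, `K = E ⊕ Eω`, and let `W` be a
3-dimensional `E`-space with an injective `σ`-semilinear map `f`, where `σ` has fixed field `F`.
Take `U = {f x + ω x : x ∈ W}` inside `W ⊗ K`. A scalar `A + Bω` with `B ≠ 0` sending a nonzero
vector of `U` into `U` forces `f (f x)` into the `E`-span of `f x` and `x`; if `B = 0` it forces `σ
A = A` (`exists_hasTrivialScalars_of_semilinear`).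

The map `f` is chosen so that some iterate is an `E`-linear map `T` annihilated by an irreducible
polynomial over `F` of degree at least 3. A quadratic relation would give an `f`-invariant space of
dimension at most 2, on which the minimal polynomial of `T` is fixed by `σ`, hence defined over `F`,
hence of degree at least 3: a contradiction (`apply_apply_ne_of_iterate_eq`). -/

namespace LinearSets
open Polynomial

/-! ### Invariant subspaces of semilinear maps -/

section Semilinear

variable {F E W : Type*} [Field F] [Field E] [Algebra F E] [AddCommGroup W] [Module E W]

theorem aeval_map_apply_semilinear (σ : E →ₐ[F] E) (f : W →+ W)
    (hf : ∀ (e : E) (x : W), f (e • x) = σ e • f x) (T : Module.End E W)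
    (hfT : ∀ x, f (T x) = T (f x)) (p : E[X]) (x : W) :
    aeval T (p.map σ.toRingHom) (f x) = f (aeval T p x) := by
  have hpow : ∀ (k : ℕ) (y : W), (T ^ k) (f y) = f ((T ^ k) y) := by
    intro k
    induction k with
    | zero => intro y; rfl
    | succ k ih => intro y; simp only [pow_succ', Module.End.mul_apply, ih, hfT]
  induction p using Polynomial.induction_on' with
  | add p r hp hr => simp only [Polynomial.map_add, map_add, LinearMap.add_apply, hp, hr]
  | monomial k e =>
    simp only [Polynomial.map_monomial, aeval_monomial, Module.End.mul_apply,
      Module.algebraMap_end_apply, hpow, hf]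
    rfl

/-- If the `E`-linear map `T` commutes with a surjective semilinear map whose companion
automorphism has fixed field `F`, then an irreducible polynomial over `F` annihilating `T` has
degree at most the dimension of the space. -/
theorem natDegree_le_finrank_of_commute_semilinear [FiniteDimensional E W] [Nontrivial W]
    (σ : E →ₐ[F] E) (hσ : ∀ e, σ e = e → e ∈ (algebraMap F E).range) (f : W →+ W)
    (hf : ∀ (e : E) (x : W), f (e • x) = σ e • f x) (hsurj : Function.Surjective f)
    (T : Module.End E W) (hfT : ∀ x, f (T x) = T (f x)) {g : F[X]} (hg : Irreducible g)
    (hgT : aeval T (g.map (algebraMap F E)) = 0) :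
    g.natDegree ≤ Module.finrank E W := by
  have hT : IsIntegral E T := Algebra.IsIntegral.isIntegral T
  set p := minpoly E T with hp
  have hmonic : p.Monic := minpoly.monic hT
  -- Since `f ∘ p(T) = p^σ(T) ∘ f` and `f` is onto, `p^σ` also annihilates `T`; it is monic of the
  -- same degree as `p`.
  have hfix : p.map σ.toRingHom = p := by
    have h0 : aeval T (p.map σ.toRingHom) = 0 := by
      ext y
      obtain ⟨x, rfl⟩ := hsurj y
      rw [aeval_map_apply_semilinear σ f hf T hfT, hp, minpoly.aeval]
      simp
    exact (Polynomial.eq_of_monic_of_dvd_of_natDegree_le hmonic (hmonic.map _)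
      (minpoly.dvd E T h0) (by rw [hmonic.natDegree_map]))
  obtain ⟨p₀, hp₀⟩ : ∃ p₀ : F[X], p₀.map (algebraMap F E) = p := by
    rw [← Polynomial.mem_lifts, Polynomial.lifts_iff_coeff_lifts]
    intro k
    apply hσ
    conv_rhs => rw [← hfix, coeff_map]
    rfl
  have hdvd : p₀ ∣ g := by
    rw [← Polynomial.map_dvd_map' (algebraMap F E), hp₀]
    exact minpoly.dvd E T hgT
  have hunit : ¬ IsUnit p₀ := fun h => minpoly.not_isUnit E T <| by
    rw [← hp, ← hp₀]; exact h.map (mapRingHom (algebraMap F E))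
  have hass : Associated p₀ g := (hg.dvd_iff.mp hdvd).resolve_left hunit |>.symm
  calc g.natDegree = p₀.natDegree :=
        (Polynomial.natDegree_eq_of_degree_eq (Polynomial.degree_eq_degree_of_associated hass)).symm
    _ = p.natDegree := by rw [← hp₀, natDegree_map]
    _ ≤ T.charpoly.natDegree :=
        natDegree_le_of_dvd (LinearMap.minpoly_dvd_charpoly T) T.charpoly_monic.ne_zero
    _ = Module.finrank E W := T.charpoly_natDegree

/-- A semilinear map one of whose iterates is linear and annihilated by an irreducible polynomial
of degree at least three has no quadratic relation on a nonzero vector. -/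
theorem apply_apply_ne_of_iterate_eq [Finite W]
    (σ : E →ₐ[F] E) (hσ : ∀ e, σ e = e → e ∈ (algebraMap F E).range) (f : W →+ W)
    (hf : ∀ (e : E) (x : W), f (e • x) = σ e • f x) (hinj : Function.Injective f)
    (T : Module.End E W) (n : ℕ) (hT : ∀ x, T x = f^[n] x) {g : F[X]} (hg : Irreducible g)
    (hgT : aeval T (g.map (algebraMap F E)) = 0) (hdeg : 3 ≤ g.natDegree)
    {x : W} (hx : x ≠ 0) (β γ : E) : f (f x) ≠ β • f x + γ • x := by
  intro hrel
  -- The relation makes this span `f`-invariant, so the degree bound applies to the restrictions of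
  -- `f` and `T` to it.
  let S : Submodule E W := Submodule.span E {f x, x}
  have hSf : ∀ y ∈ S, f y ∈ S := by
    intro y hy
    obtain ⟨c, d, rfl⟩ := Submodule.mem_span_pair.mp hy
    rw [map_add, hf, hf, hrel]
    have h1 : f x ∈ S := Submodule.subset_span (by simp)
    have h2 : x ∈ S := Submodule.subset_span (by simp)
    exact S.add_mem (S.smul_mem _ (S.add_mem (S.smul_mem _ h1) (S.smul_mem _ h2)))
      (S.smul_mem _ h1)
  have hST : ∀ y ∈ S, T y ∈ S := by
    intro y hy
    rw [hT]
    exact Set.MapsTo.iterate (s := (S : Set W)) hSf n hy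
  let fS : S →+ S := (f.comp S.subtype.toAddMonoidHom).codRestrict S fun y => hSf y y.2
  have hfS : ∀ y : S, (fS y : W) = f y := fun y => rfl
  have hfSinj : Function.Injective fS := fun y z h =>
    Subtype.ext (hinj (by rw [← hfS, ← hfS, h]))
  let TS : Module.End E S := T.restrict hST
  have hTS : ∀ (p : E[X]) (y : S), (aeval TS p y : W) = aeval T p y := by
    intro p y
    have hpow : ∀ k : ℕ, ((TS ^ k) y : W) = (T ^ k) y := by
      intro k
      induction k with
      | zero => rfl
      | succ k ih => rw [pow_succ', pow_succ', Module.End.mul_apply, Module.End.mul_apply, ← ih]; rfl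
    induction p using Polynomial.induction_on' with
    | add p r hp hr => simp only [map_add, LinearMap.add_apply, Submodule.coe_add, hp, hr]
    | monomial k e =>
      simp only [aeval_monomial, Module.End.mul_apply, Module.algebraMap_end_apply,
        Submodule.coe_smul, hpow]
  have : Nontrivial S := ⟨⟨x, Submodule.subset_span (by simp)⟩, 0, fun h => hx (by
    simpa using congrArg Subtype.val h)⟩
  have : Module.Finite E W := Module.Finite.of_finite
  have hle : g.natDegree ≤ Module.finrank E S := by
    refine natDegree_le_finrank_of_commute_semilinear σ hσ fS (fun e y => Subtype.ext ?_)
      (Finite.surjective_of_injective hfSinj) TS (fun y => Subtype.ext ?_) hg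
      (LinearMap.ext fun y => Subtype.ext ?_)
    · simp [hfS, hf]
    · change f (T y) = T (f y)
      rw [hT, hT, ← Function.iterate_succ_apply' f, ← Function.iterate_succ_apply f]
    · rw [hTS, hgT]; rfl
  have hS2 : Module.finrank E S ≤ 2 := by
    classical
    have h := finrank_span_finset_le_card (R := E) ({f x, x} : Finset W)
    rw [Finset.coe_insert, Finset.coe_singleton] at h
    exact h.trans Finset.card_le_two
  omega

end Semilinear

/-! ### Elements of degree three over a finite field -/

section FiniteFields

/-- The exponent is that of the norm from `M` to its subfield of order `q ^ 3`. The norm of a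
generator of `Mˣ` has order `q ^ 3 - 1`, too large for it to be fixed by the `q`-th power map. -/
theorem exists_pow_geomSum_pow_ne {M : Type*} [Field M] [Finite M] {q m : ℕ} (hq : 2 ≤ q)
    (hM : Nat.card M = (q ^ 3) ^ m) :
    ∃ a : M, a ≠ 0 ∧ (a ^ ∑ i ∈ Finset.range m, (q ^ 3) ^ i) ^ q ^ 3 =
        a ^ ∑ i ∈ Finset.range m, (q ^ 3) ^ i ∧
      (a ^ ∑ i ∈ Finset.range m, (q ^ 3) ^ i) ^ q ≠ a ^ ∑ i ∈ Finset.range m, (q ^ 3) ^ i := by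
  obtain ⟨g, hg⟩ := IsCyclic.exists_generator (α := Mˣ)
  have hord : orderOf g = (q ^ 3) ^ m - 1 := by
    rw [orderOf_eq_card_of_forall_mem_zpowers hg, Nat.card_units, hM]
  set s := ∑ i ∈ Finset.range m, (q ^ 3) ^ i with hs
  have hq3 : q < q ^ 3 := by
    calc q = q ^ 1 := (pow_one q).symm
      _ < q ^ 3 := Nat.pow_lt_pow_right (by omega) (by norm_num)
  have hmul : s * (q ^ 3 - 1) = (q ^ 3) ^ m - 1 := geom_sum_mul_of_one_le (by omega) m
  have hs0 : 0 < s := by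
    have : 1 < Nat.card M := Finite.one_lt_card
    refine Nat.pos_of_ne_zero fun h => ?_
    rw [h, zero_mul, ← hM] at hmul
    omega
  refine ⟨g, g.ne_zero, ?_, fun h => ?_⟩
  · have h1 : (g ^ s) ^ (q ^ 3 - 1) = 1 := by rw [← pow_mul, hmul, ← hord, pow_orderOf_eq_one]
    have h2 : (g ^ s) ^ q ^ 3 = g ^ s := by
      rw [← Nat.sub_add_cancel (show 1 ≤ q ^ 3 by omega), pow_succ, h1, one_mul]
    exact_mod_cast congrArg Units.val h2
  · have h2 : (g ^ s) ^ q = g ^ s := by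
      apply Units.ext; exact_mod_cast h
    have h1 : (g ^ s) ^ (q - 1) = 1 := by
      rw [← Nat.sub_add_cancel (show 1 ≤ q by omega), pow_succ] at h2
      exact mul_eq_right.mp h2
    rw [← pow_mul, ← orderOf_dvd_iff_pow_eq_one, hord, ← hmul] at h1
    have := Nat.le_of_dvd (by omega) (Nat.dvd_of_mul_dvd_mul_left hs0 h1)
    omega

variable {F M : Type*} [Field F] [Finite F] [Field M] [Finite M] [Algebra F M]

omit [Finite F] in
theorem pow_card_pow_natDegree_minpoly (θ : M) :
    θ ^ Nat.card F ^ (minpoly F θ).natDegree = θ := by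
  have : Fintype (IntermediateField.adjoin F {θ}) := Fintype.ofFinite _
  have hfin : Module.finrank F (IntermediateField.adjoin F {θ}) = (minpoly F θ).natDegree :=
    IntermediateField.adjoin.finrank (Algebra.IsIntegral.isIntegral θ)
  have h := FiniteField.pow_card (IntermediateField.AdjoinSimple.gen F θ)
  rw [← Nat.card_eq_fintype_card, Module.natCard_eq_pow_finrank (K := F), hfin] at h
  simpa using congrArg Subtype.val h

omit [Finite F] in
theorem three_le_natDegree_minpoly {θ : M} (h3 : θ ^ Nat.card F ^ 3 = θ)
    (h1 : θ ^ Nat.card F ≠ θ) : 3 ≤ (minpoly F θ).natDegree := by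
  by_contra! hlt
  have h := pow_card_pow_natDegree_minpoly (F := F) θ
  have hpos := minpoly.natDegree_pos (Algebra.IsIntegral.isIntegral (R := F) θ)
  interval_cases hd : (minpoly F θ).natDegree
  · exact h1 (by simpa using h)
  -- In degree 2, `θ ^ q ^ 3 = (θ ^ q ^ 2) ^ q = θ ^ q`.
  · rw [pow_succ, pow_mul, h] at h3
    exact h1 h3

theorem mem_range_algebraMap_of_pow_card {e : M} (he : e ^ Nat.card F = e) :
    e ∈ (algebraMap F M).range := by
  refine (IsGalois.mem_range_algebraMap_iff_fixed e).mpr fun g => ?_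
  have : Fintype F := Fintype.ofFinite F
  obtain ⟨k, rfl⟩ := (FiniteField.bijective_frobeniusAlgEquivOfAlgebraic_pow F M).2 g
  rw [AlgEquiv.coe_pow]
  exact Function.iterate_fixed (by simpa [Nat.card_eq_fintype_card] using he) _

end FiniteFields

/-! ### Semilinear maps without quadratic relations -/

section ExistsSemilinear

theorem frobeniusAlgHom_pow_apply {F R : Type*} [Field F] [Fintype F] [CommRing R] [Algebra F R]
    (k : ℕ) (x : R) : (FiniteField.frobeniusAlgHom F R ^ k) x = x ^ Nat.card F ^ k := by
  rw [AlgHom.coe_pow, FiniteField.coe_frobeniusAlgHom, pow_iterate, Nat.card_eq_fintype_card]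

theorem frobeniusAlgHom_apply {F R : Type*} [Field F] [Fintype F] [CommRing R] [Algebra F R]
    (x : R) : FiniteField.frobeniusAlgHom F R x = x ^ Nat.card F := by
  rw [FiniteField.coe_frobeniusAlgHom, Nat.card_eq_fintype_card]

theorem pow_natCard {M : Type*} [Field M] [Finite M] (x : M) : x ^ Nat.card M = x := by
  have : Fintype M := Fintype.ofFinite M
  rw [Nat.card_eq_fintype_card, FiniteField.pow_card]

theorem iterate_mul_pow {M : Type*} [CommMonoid M] (a : M) (Q k : ℕ) (x : M) :
    (fun y => a * y ^ Q)^[k] x = a ^ (∑ i ∈ Finset.range k, Q ^ i) * x ^ Q ^ k := by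
  induction k with
  | zero => simp
  | succ k ih =>
    rw [Function.iterate_succ_apply', ih, mul_pow, ← pow_mul, ← pow_mul, ← mul_assoc, ← pow_succ',
      Finset.sum_range_succ', ← pow_succ, pow_zero, Finset.sum_mul]
    simp only [pow_succ]

/-- Over an extension `E` of `F` of degree prime to three, a semilinear map on the cubic extension
of `E` without quadratic relations. -/
theorem exists_semilinear_of_coprime {F E M : Type*} [Field F] [Finite F] [Field E] [Finite E]
    [Algebra F E] [Field M] [Finite M] [Algebra F M] [Algebra E M] [IsScalarTower F E M]
    (h3 : Nat.Coprime 3 (Module.finrank F E)) (hM : Module.finrank E M = 3) :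
    ∃ (σ : E →ₐ[F] E) (f : M →+ M), (∀ e, σ e = e → e ∈ (algebraMap F E).range) ∧
      (∀ (e : E) (x : M), f (e • x) = σ e • f x) ∧ Function.Injective f ∧
      ∀ x ≠ 0, ∀ β γ : E, f (f x) ≠ β • f x + γ • x := by
  have : Fintype F := Fintype.ofFinite F
  set n := Module.finrank F E with hn
  have hcardE : Nat.card E = Nat.card F ^ n := Module.natCard_eq_pow_finrank
  have hcard : Nat.card M = (Nat.card F ^ 3) ^ n := by
    rw [Module.natCard_eq_pow_finrank (K := E), hM, hcardE, ← pow_mul, ← pow_mul, mul_comm]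
  obtain ⟨a, ha, hθ3, hθ1⟩ := exists_pow_geomSum_pow_ne (Finite.one_lt_card : 2 ≤ Nat.card F) hcard
  set θ := a ^ ∑ i ∈ Finset.range n, (Nat.card F ^ 3) ^ i with hθ
  -- The `n`-th iterate of `x ↦ a * x ^ q ^ 3` is multiplication by the norm `θ` of `a`, because `q
  -- ^ (3 * n)` is the order of `M`.
  let f : M →+ M := (AddMonoidHom.mulLeft a).comp
    (FiniteField.frobeniusAlgHom F M ^ 3 : M →ₐ[F] M).toRingHom.toAddMonoidHom
  have hfx : ∀ x, f x = a * x ^ Nat.card F ^ 3 := fun x =>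
    congrArg (a * ·) (frobeniusAlgHom_pow_apply 3 x)
  have hσ : ∀ e, (FiniteField.frobeniusAlgHom F E ^ 3 : E →ₐ[F] E) e = e →
      e ∈ (algebraMap F E).range := by
    intro e he
    apply mem_range_algebraMap_of_pow_card
    rw [frobeniusAlgHom_pow_apply] at he
    have hp3 : Function.IsPeriodicPt (fun y : E => y ^ Nat.card F) 3 e := by
      rw [Function.IsPeriodicPt, pow_iterate]; exact he
    have hpn : Function.IsPeriodicPt (fun y : E => y ^ Nat.card F) n e := by
      rw [Function.IsPeriodicPt, pow_iterate, ← hcardE]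
      exact pow_natCard e
    -- Periods 3 and `n` are coprime, so `e` is fixed by the `q`-th power map itself.
    have := hp3.gcd hpn
    rwa [h3] at this
  have hf : ∀ (e : E) (x : M), f (e • x) = (FiniteField.frobeniusAlgHom F E ^ 3) e • f x := by
    intro e x
    rw [hfx, hfx, frobeniusAlgHom_pow_apply, _root_.smul_pow, mul_smul_comm]
  have hinj : Function.Injective f := (injective_iff_map_eq_zero f).mpr fun x hx => by
    rw [hfx] at hx
    exact eq_zero_of_pow_eq_zero ((mul_eq_zero.mp hx).resolve_left ha)
  refine ⟨_, f, hσ, hf, hinj, fun x hx => apply_apply_ne_of_iterate_eq _ hσ f hf hinj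
    (Algebra.lmul E M θ) n (fun y => ?_)
    (minpoly.irreducible (Algebra.IsIntegral.isIntegral (R := F) θ)) ?_
    (three_le_natDegree_minpoly hθ3 hθ1) hx⟩
  · have hfun : (f : M → M) = fun y => a * y ^ Nat.card F ^ 3 := funext hfx
    rw [hfun, iterate_mul_pow, ← hcard, pow_natCard]
    rfl
  · rw [aeval_algHom_apply, aeval_map_algebraMap, minpoly.aeval, map_zero]

/-- Over an extension `E` of `F` of degree divisible by three, a semilinear map on `E ^ 3` without
quadratic relations. -/
theorem exists_semilinear_of_dvd {F E : Type*} [Field F] [Finite F] [Field E] [Finite E]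
    [Algebra F E] (h3 : 3 ∣ Module.finrank F E) :
    ∃ (σ : E →ₐ[F] E) (f : (Fin 3 → E) →+ (Fin 3 → E)),
      (∀ e, σ e = e → e ∈ (algebraMap F E).range) ∧
      (∀ (e : E) (x : Fin 3 → E), f (e • x) = σ e • f x) ∧ Function.Injective f ∧
      ∀ x ≠ 0, ∀ β γ : E, f (f x) ≠ β • f x + γ • x := by
  have : Fintype F := Fintype.ofFinite F
  obtain ⟨m, hm⟩ := h3
  set q := Nat.card F with hq
  have hcard : Nat.card E = (q ^ 3) ^ m := by
    rw [Module.natCard_eq_pow_finrank (K := F), hm, pow_mul]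
  obtain ⟨b, hb, hθ3, hθ1⟩ := exists_pow_geomSum_pow_ne (Finite.one_lt_card : 2 ≤ Nat.card F) hcard
  rw [← hq] at hθ3 hθ1
  set θ := b ^ ∑ i ∈ Finset.range m, (q ^ 3) ^ i with hθ
  let σ := FiniteField.frobeniusAlgHom F E
  have hσq : ∀ e, σ e = e ^ q := frobeniusAlgHom_apply
  -- A cyclic shift twisted by Frobenius and `b`: its cube is diagonal, and its `3 * m`-th iterate
  -- multiplies coordinate `i` by `θ ^ q ^ i`, a conjugate of `θ` over `F`.
  let f : (Fin 3 → E) →+ (Fin 3 → E) :=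
    { toFun := fun w => ![b * σ (w 2), σ (w 0), σ (w 1)]
      map_zero' := by simp
      map_add' := fun v w => by simp [mul_add] }
  have hfx : ∀ w, f w = ![b * σ (w 2), σ (w 0), σ (w 1)] := fun w => rfl
  have hσ : ∀ e, σ e = e → e ∈ (algebraMap F E).range := fun e he =>
    mem_range_algebraMap_of_pow_card (by rw [← hq, ← hσq, he])
  have hf : ∀ (e : E) (x : Fin 3 → E), f (e • x) = σ e • f x := by
    intro e x
    simp only [hfx, Pi.smul_apply, smul_eq_mul, map_mul, Matrix.smul_cons, Matrix.smul_empty]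
    rw [mul_left_comm]
  have hinj : Function.Injective f := (injective_iff_map_eq_zero f).mpr fun x hx => by
    rw [hfx] at hx
    have h0 := congrFun hx 0
    have h1 := congrFun hx 1
    have h2 := congrFun hx 2
    simp [hb] at h0 h1 h2
    ext i
    fin_cases i <;> assumption
  have hf3 : ∀ w i, f^[3] w i = b ^ q ^ (i : ℕ) * w i ^ q ^ 3 := by
    intro w i
    simp only [Function.iterate_succ, Function.iterate_zero, Function.comp_apply, id, hfx, hσq]
    fin_cases i <;> simp [mul_pow, ← pow_mul, pow_succ]
  have hfm : ∀ k w i, (f^[3])^[k] w i =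
      (fun y => b ^ q ^ (i : ℕ) * y ^ q ^ 3)^[k] (w i) := by
    intro k w i
    induction k with
    | zero => rfl
    | succ k ih =>
      rw [Function.iterate_succ_apply' (f := f^[3]), hf3, ih, Function.iterate_succ_apply']
  refine ⟨σ, f, hσ, hf, hinj, fun x hx => apply_apply_ne_of_iterate_eq _ hσ f hf hinj
    (Algebra.lmul E (Fin 3 → E) fun i => θ ^ q ^ (i : ℕ)) (3 * m) (fun y => ?_)
    (minpoly.irreducible (Algebra.IsIntegral.isIntegral (R := F) θ)) ?_
    (three_le_natDegree_minpoly hθ3 hθ1) hx⟩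
  · rw [Function.iterate_mul]
    ext i
    rw [hfm, iterate_mul_pow, ← hcard, pow_natCard, ← pow_mul, mul_comm (q ^ (i : ℕ)), pow_mul]
    rfl
  · rw [aeval_algHom_apply, aeval_map_algebraMap]
    refine (congrArg _ (funext fun i => ?_)).trans (map_zero (Algebra.lmul E (Fin 3 → E)))
    have h1 := aeval_algHom_apply (Pi.evalAlgHom F (fun _ : Fin 3 => E) i)
      (fun i : Fin 3 => θ ^ q ^ (i : ℕ)) (minpoly F θ)
    rw [Pi.evalAlgHom_apply, Pi.evalAlgHom_apply] at h1
    rw [← h1, ← frobeniusAlgHom_pow_apply, aeval_algHom_apply, minpoly.aeval, map_zero]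
    rfl

end ExistsSemilinear

/-! ### Construction of the scattered subspaces -/

section Scattered

variable {F K V : Type*} [Field F] [Field K] [Algebra F K]
  [AddCommGroup V] [Module F V] [Module K V]

/-- The only scalars of `K` that map a nonzero vector of `U` into `U` are those of `F`. -/
def HasTrivialScalars (K : Type*) [Field K] [Algebra F K] [Module K V] (U : Submodule F V) : Prop :=
  ∀ u ∈ U, u ≠ 0 → ∀ c : K, c • u ∈ U → c ∈ (algebraMap F K).range

theorem HasTrivialScalars.isScattered [IsScalarTower F K V] {U : Submodule F V}
    (hU : HasTrivialScalars K U) : IsScattered K U := by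
  rintro _ ⟨u, hu, huU, rfl⟩
  have h : U ⊓ (Projectivization.mk K u hu).submodule.restrictScalars F = Submodule.span F {u} := by
    ext v
    rw [Submodule.mem_inf, Submodule.restrictScalars_mem, Projectivization.submodule_mk,
      Submodule.mem_span_singleton, Submodule.mem_span_singleton]
    constructor
    · rintro ⟨hv, c, rfl⟩
      obtain ⟨d, rfl⟩ := hU u huU hu c hv
      exact ⟨d, (algebraMap_smul K d u).symm⟩
    · rintro ⟨d, rfl⟩
      exact ⟨U.smul_mem d huU, algebraMap F K d, algebraMap_smul K d u⟩
  rw [weight, h, finrank_span_singleton hu]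

theorem HasTrivialScalars.map {V' : Type*} [AddCommGroup V'] [Module F V'] [Module K V']
    [IsScalarTower F K V] [IsScalarTower F K V'] {U : Submodule F V}
    (hU : HasTrivialScalars K U) (e : V ≃ₗ[K] V') :
    HasTrivialScalars K (U.map (e.restrictScalars F : V →ₗ[F] V')) := by
  rintro _ ⟨u, hu, rfl⟩ hne c ⟨v, hv, hvu⟩
  refine hU u hu (fun h => hne (by simp [h])) c ?_
  have : v = c • u := e.injective (by simpa using hvu)
  exact this ▸ hv

theorem HasTrivialScalars.prod {V' : Type*} [AddCommGroup V'] [Module F V'] [Module K V']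
    {U : Submodule F V} {U' : Submodule F V'}
    (hU : HasTrivialScalars K U) (hU' : HasTrivialScalars K U') :
    HasTrivialScalars K (U.prod U') := by
  rintro ⟨u, u'⟩ ⟨hu, hu'⟩ hne c ⟨hcu, hcu'⟩
  by_cases h : u = 0
  · exact hU' u' hu' (fun h' => hne (by rw [h, h']; rfl)) c hcu'
  · exact hU u hu h c hcu

/-- The product of two submodules as the product of the modules. -/
def prodEquivProd {V' : Type*} [AddCommGroup V'] [Module F V'] (U : Submodule F V)
    (U' : Submodule F V') : U.prod U' ≃ₗ[F] U × U' where
  toFun v := (⟨v.1.1, v.2.1⟩, ⟨v.1.2, v.2.2⟩)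
  invFun v := ⟨(v.1, v.2), v.1.2, v.2.2⟩
  map_add' _ _ := rfl
  map_smul' _ _ := rfl
  left_inv _ := rfl
  right_inv _ := rfl

/-- No `F`-structure on `W` is needed: the image is closed under scalars, and its rank is read off
from its cardinality. -/
theorem exists_submodule_coe_eq_range [Finite F] {W : Type*} [AddCommGroup W] [Finite W]
    (u : W →+ V) (hu : Function.Injective u) (hsmul : ∀ (c : F) x, ∃ y, u y = c • u x) {k : ℕ}
    (hk : Nat.card W = Nat.card F ^ k) :
    ∃ U : Submodule F V, (∀ v, v ∈ U ↔ ∃ x, u x = v) ∧ Module.finrank F U = k := by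
  let U : Submodule F V :=
    { u.range with
      smul_mem' := by
        rintro c _ ⟨x, rfl⟩
        exact hsmul c x }
  have hmem : ∀ v, v ∈ U ↔ ∃ x, u x = v := fun v => Iff.rfl
  let g : W ≃ U := Equiv.ofBijective (fun x => ⟨u x, x, rfl⟩)
    ⟨fun x y h => hu (congrArg Subtype.val h), fun ⟨v, x, hx⟩ => ⟨x, Subtype.ext hx⟩⟩
  have : Finite U := Finite.of_equiv W g
  refine ⟨U, hmem, Nat.pow_right_injective (Finite.one_lt_card : 2 ≤ Nat.card F) ?_⟩
  change Nat.card F ^ _ = Nat.card F ^ _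
  rw [← hk, ← Module.natCard_eq_pow_finrank, Nat.card_congr g]

/-- The scattered linear set of the vectors `(x, x ^ q)` on the projective line. -/
theorem exists_hasTrivialScalars_fin_two [Finite F] [Finite K] :
    ∃ U : Submodule F (Fin 2 → K),
      Module.finrank F U = Module.finrank F K ∧ HasTrivialScalars K U := by
  have : Fintype F := Fintype.ofFinite F
  let σ := FiniteField.frobeniusAlgHom F K
  let u : K →+ (Fin 2 → K) :=
    { toFun := fun x => ![x, σ x]
      map_zero' := by simp
      map_add' := fun x y => by simp }
  have hux : ∀ x, u x = ![x, σ x] := fun x => rfl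
  obtain ⟨U, hU, hfin⟩ := exists_submodule_coe_eq_range (F := F) u
    (fun x y h => by simpa [hux] using congrFun h 0) (fun c x => ⟨c • x, by simp [hux]⟩)
    Module.natCard_eq_pow_finrank
  refine ⟨U, hfin, fun v hv hne c hc => ?_⟩
  obtain ⟨x, rfl⟩ := (hU _).mp hv
  obtain ⟨y, hy⟩ := (hU _).mp hc
  have hx : x ≠ 0 := fun h => hne (by rw [h, map_zero])
  have h0 : y = c * x := by simpa [hux] using congrFun hy 0
  have h1 : σ y = c * σ x := by simpa [hux] using congrFun hy 1
  apply mem_range_algebraMap_of_pow_card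
  rw [h0, map_mul] at h1
  have hc : σ c = c := mul_right_cancel₀ ((map_ne_zero σ).mpr hx) h1
  rw [← frobeniusAlgHom_apply, hc]

/-- A semilinear map without quadratic relations over a subfield of index two gives a scattered
linear set. -/
theorem exists_hasTrivialScalars_of_semilinear {E W : Type*} [Finite F] [Field E] [Finite E]
    [Algebra F E] [Algebra E K] [IsScalarTower F E K] (hEK : Module.finrank E K = 2)
    [AddCommGroup W] [Module E W] {d : ℕ} (hd : 0 < d) (hW : Module.finrank E W = d)
    (σ : E →ₐ[F] E) (f : W →+ W) (hσ : ∀ e, σ e = e → e ∈ (algebraMap F E).range)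
    (hf : ∀ (e : E) (x : W), f (e • x) = σ e • f x) (hinj : Function.Injective f)
    (hrel : ∀ x ≠ 0, ∀ β γ : E, f (f x) ≠ β • f x + γ • x) :
    ∃ U : Submodule F (Fin d → K),
      Module.finrank F U = d * Module.finrank F E ∧ HasTrivialScalars K U := by
  obtain ⟨ω, hω⟩ : ∃ ω : K, ω ∉ (algebraMap E K).range := by
    by_contra! h
    have hbot : (⊥ : Subalgebra E K) = ⊤ := by
      ext x; simpa [Algebra.mem_bot] using h x
    have := Subalgebra.bot_eq_top_iff_finrank_eq_one.mp hbot
    omega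
  have huniq : ∀ a b c e : E, algebraMap E K a + algebraMap E K b * ω =
      algebraMap E K c + algebraMap E K e * ω → a = c ∧ b = e := by
    intro a b c e h
    have hbe : b = e := by
      by_contra hne
      refine hω ⟨(c - a) / (b - e), ?_⟩
      have : algebraMap E K (b - e) ≠ 0 := by simpa [sub_eq_zero] using hne
      rw [map_div₀, div_eq_iff this, map_sub, map_sub]
      linear_combination -h
    subst hbe
    exact ⟨(algebraMap E K).injective (add_right_cancel h), rfl⟩
  have hspan : ∀ c : K, ∃ a b : E, c = algebraMap E K a + algebraMap E K b * ω := by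
    have hli : LinearIndependent E ![(1 : K), ω] := by
      rw [LinearIndependent.pair_iff]
      intro s t h
      have := huniq s t 0 0 (by simpa [Algebra.smul_def] using h)
      exact this
    intro c
    have hc : c ∈ Submodule.span E (Set.range ![(1 : K), ω]) := by
      rw [hli.span_eq_top_of_card_eq_finrank (by simp [hEK])]
      trivial
    rw [Matrix.range_cons, Matrix.range_cons, Matrix.range_empty, Set.union_empty,
      Set.singleton_union, Submodule.mem_span_pair] at hc
    obtain ⟨a, b, rfl⟩ := hc
    exact ⟨a, b, by simp [Algebra.smul_def]⟩
  have : Module.Finite E W := Module.finite_of_finrank_pos (by omega)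
  have : Finite W := Module.finite_of_finite E
  let e : W ≃ₗ[E] (Fin d → E) := LinearEquiv.ofFinrankEq _ _ (by simp [hW])
  let u : W →+ (Fin d → K) :=
    { toFun := fun x i => algebraMap E K (e (f x) i) + algebraMap E K (e x i) * ω
      map_zero' := by ext i; simp
      map_add' := fun x y => by ext i; simp; ring }
  have hux : ∀ x i, u x i = algebraMap E K (e (f x) i) + algebraMap E K (e x i) * ω :=
    fun x i => rfl
  have hu : Function.Injective u := fun x y h => e.injective <| funext fun i =>
    (huniq _ _ _ _ (congrFun h i)).2
  obtain ⟨U, hU, hfin⟩ := exists_submodule_coe_eq_range (F := F) u hu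
    (fun c x => ⟨algebraMap F E c • x, by
      ext i
      simp [hux, hf, Algebra.smul_def, IsScalarTower.algebraMap_apply F E K]
      ring⟩) (k := d * Module.finrank F E) (by
      rw [Module.natCard_eq_pow_finrank (K := E), Module.natCard_eq_pow_finrank (K := F) (V := E),
        hW, ← pow_mul, mul_comm])
  refine ⟨U, hfin, fun v hv hne c hc => ?_⟩
  obtain ⟨x, rfl⟩ := (hU _).mp hv
  obtain ⟨y, hy⟩ := (hU _).mp hc
  have hx : x ≠ 0 := fun h => hne (by rw [h, map_zero])
  obtain ⟨A, B, rfl⟩ := hspan c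
  obtain ⟨C, D, hCD⟩ := hspan (ω * ω)
  -- Expand `(A + Bω)(f x + ω x) = f y + ω y` using `ω ^ 2 = C + Dω` and compare coefficients of `1`
  -- and `ω`.
  have hcoord : ∀ i, e (f y) i = (A • e (f x) + (B * C) • e x) i ∧
      e y i = ((A + B * D) • e x + B • e (f x)) i := fun i => by
    apply huniq
    rw [← hux, hy]
    simp [hux]
    linear_combination algebraMap E K B * algebraMap E K (e x i) * hCD
  have hfy : f y = A • f x + (B * C) • x := e.injective <| by
    rw [map_add, map_smul, map_smul]; exact funext fun i => (hcoord i).1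
  have hy' : y = (A + B * D) • x + B • f x := e.injective <| by
    rw [map_add, map_smul, map_smul]; exact funext fun i => (hcoord i).2
  rw [hy', map_add, hf, hf] at hfy
  have hfx : f x ≠ 0 := (map_ne_zero_iff f hinj).mpr hx
  by_cases hB : B = 0
  · subst hB
    simp only [zero_mul, add_zero, map_zero, zero_smul] at hfy
    obtain ⟨a, ha⟩ := hσ A (smul_left_injective E hfx hfy)
    exact ⟨a, by rw [← ha, map_zero, zero_mul, add_zero, ← IsScalarTower.algebraMap_apply]⟩
  · exfalso
    have hσB : σ B ≠ 0 := (map_ne_zero σ).mpr hB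
    -- Applying `f` to the formula for `y` gives `σ (A + BD) f x + σ B f (f x) = A f x + BC x`,
    -- solved here for `f (f x)`.
    refine hrel x hx ((σ B)⁻¹ * (A - σ (A + B * D))) ((σ B)⁻¹ * (B * C)) ?_
    rw [mul_smul, mul_smul, ← smul_add, eq_inv_smul_iff₀ hσB, sub_smul]
    rw [← sub_eq_zero] at hfy ⊢
    rw [← hfy]
    abel

/-- Cauchy's theorem gives an involution in the Galois group, whose fixed field has index two. -/
theorem exists_intermediateField_finrank_eq_two [Finite F] [Finite K]
    (h : Even (Module.finrank F K)) : ∃ E : IntermediateField F K, Module.finrank E K = 2 := by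
  have hcard : Nat.card Gal(K/F) = Module.finrank F K := IsGalois.card_aut_eq_finrank F K
  obtain ⟨g, hg⟩ := exists_prime_orderOf_dvd_card' 2 (hcard ▸ h.two_dvd)
  exact ⟨IntermediateField.fixedField (Subgroup.zpowers g), by
    rw [IntermediateField.finrank_fixedField_eq_card, Nat.card_zpowers, hg]⟩

theorem exists_hasTrivialScalars_fin_three [Finite F] [Finite K]
    (h : Even (Module.finrank F K)) : ∃ U : Submodule F (Fin 3 → K),
      Module.finrank F U = 3 * (Module.finrank F K / 2) ∧ HasTrivialScalars K U := by
  obtain ⟨E, hE⟩ := exists_intermediateField_finrank_eq_two h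
  have hFE : Module.finrank F K / 2 = Module.finrank F E := by
    rw [← Module.finrank_mul_finrank F E K, hE, Nat.mul_div_cancel _ two_pos]
  rw [hFE]
  -- The element `θ` of degree 3 over `F` lies in `E` when 3 divides the degree of `E`; otherwise it
  -- is found in a cubic extension of `E`, which then serves as `W`.
  by_cases h3 : 3 ∣ Module.finrank F E
  · obtain ⟨σ, f, hσ, hf, hinj, hrel⟩ := exists_semilinear_of_dvd h3
    exact exists_hasTrivialScalars_of_semilinear hE three_pos (by simp) σ f hσ hf hinj hrel
  · obtain ⟨p, hp⟩ := CharP.exists E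
    have : Fact p.Prime := ⟨(CharP.char_is_prime E p)⟩
    let M := FiniteField.Extension E p 3
    let : Algebra F M := ((algebraMap E M).comp (algebraMap F E)).toAlgebra
    have : IsScalarTower F E M := IsScalarTower.of_algebraMap_eq fun _ => rfl
    have hM : Module.finrank E M = 3 := FiniteField.finrank_extension E p 3
    obtain ⟨σ, f, hσ, hf, hinj, hrel⟩ := exists_semilinear_of_coprime
      ((Nat.Prime.coprime_iff_not_dvd Nat.prime_three).mpr h3) hM
    exact exists_hasTrivialScalars_of_semilinear hE three_pos hM σ f hσ hf hinj hrel

theorem exists_hasTrivialScalars_fin [Finite F] [Finite K] (h : Even (Module.finrank F K)) :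
    ∀ r, 2 ≤ r → ∃ U : Submodule F (Fin r → K),
      Module.finrank F U = r * (Module.finrank F K / 2) ∧ HasTrivialScalars K U
  | 0, hr | 1, hr => by omega
  | 2, _ => by
    obtain ⟨U, hU, hs⟩ := exists_hasTrivialScalars_fin_two (F := F) (K := K)
    exact ⟨U, by rw [hU, Nat.two_mul_div_two_of_even h], hs⟩
  | 3, _ => exists_hasTrivialScalars_fin_three h
  -- Splitting off a plane keeps the parity of the dimension, so the recursion ends at 2 or 3.
  | r + 4, _ => by
    obtain ⟨U, hU, hs⟩ := exists_hasTrivialScalars_fin h (r + 2) (by omega)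
    obtain ⟨U', hU', hs'⟩ := exists_hasTrivialScalars_fin_two (F := F) (K := K)
    let e : ((Fin (r + 2) → K) × (Fin 2 → K)) ≃ₗ[K] (Fin (r + 4) → K) :=
      LinearEquiv.ofFinrankEq _ _ (by simp)
    refine ⟨_, ?_, (hs.prod hs').map e⟩
    rw [LinearEquiv.finrank_map_eq (e.restrictScalars F), (prodEquivProd U U').finrank_eq,
      Module.finrank_prod, hU, hU']
    have := Nat.two_mul_div_two_of_even h
    linarith

end Scattered
end LinearSets

theorem theorem1p2 {F K V : Type*} [Field F] [Finite F] [Field K] [Finite K] [Algebra F K]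
    [AddCommGroup V] [Module F V] [Module K V] [IsScalarTower F K V]
    (q t r : ℕ) (hq : Nat.card F = q) (ht : Module.finrank F K = t)
    (hV : Module.finrank K V = r) (hr : 2 ≤ r) (heven : Even t)
    (hcases : (q = 2 ∧ 4 ≤ t) ∨ ¬ t ≡ 0 [MOD 3] ∨ (q ≡ 1 [MOD 3] ∧ t ≡ 0 [MOD 3])) :
    ∃ U : Submodule F V, Module.finrank F U = r * t / 2 ∧ LinearSets.IsScattered K U := by
  subst ht
  obtain ⟨U, hU, hs⟩ := LinearSets.exists_hasTrivialScalars_fin heven r hr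
  have : Module.Finite K V := Module.finite_of_finrank_pos (by omega)
  let e : (Fin r → K) ≃ₗ[K] V := LinearEquiv.ofFinrankEq _ _ (by simp [hV])
  refine ⟨_, ?_, (hs.map e).isScattered⟩
  rw [LinearEquiv.finrank_map_eq (e.restrictScalars F), hU, Nat.mul_div_assoc _ heven.two_dvd]
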